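/- Let $n,T$ be nonnegative integers. For $t=1,\dots,T$ let $L_t:\mathbb R^n\times\mathbb R^n\to\mathbb R\cup\{+\infty\}$ be proper, convex and lower semicontinuous, and let $g:\mathbb R^n\to\mathbb R\cup\{+\infty\}$ be proper, convex and lower semicontinuous. Write $\Delta x_t=x_t-x_{t-1}$, and let $\varphi^*(y)=\sup_{x\in\mathbb R^n}\{x\cdot y-\varphi(x)\}$ denote the conjugate and $\operatorname{dom}(\varphi)=\{x:\varphi(x)<+\infty\}$ the effective domain of $\varphi:\mathbb R^n\to\mathbb R\cup\{\pm\infty\}$. Put $$K_t(p,w)=\sup_{x,v\in\mathbb R^n}\{x\cdot w+v\cdot p-L_t(x,v)\},\qquad f(b)=g^*(-b),$$ and, for $\tau\in\{0,\dots,T\}$ and $\xi,\eta\in\mathbb R^n$, define the primal and dual value functions $$\vartheta_\tau(\xi)=\inf\Big\{\sum_{t=\tau+1}^T L_t(x_{t-1},\Delta x_t)+g(x_T)\ \Big|\ x_\tau,\dots,x_T\in\mathbb R^n,\ x_\tau=\xi\Big\},$$ $$\omega_\tau(\eta)=\inf\Big\{\sum_{t=\tau+1}^T K_t(p_t,\Delta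 p_t)+f(p_T)\ \Big|\ p_\tau,\dots,p_T\in\mathbb R^n,\ p_\tau=-\eta\Big\}$$ (so that $\vartheta_T(\xi)=g(\xi)$ and $\omega_T(\eta)=f(-\eta)$). Let $\Gamma_L(t,x)=\{v\in\mathbb R^n: L_t(x,v)\in\mathbb R\}$ and $X(t)=\{x\in\mathbb R^n:\Gamma_L(t,x)\ne\emptyset\}$, let $\operatorname{ri}$ denote the relative interior, and assume (H) there are $\bar x_0,\dots,\bar x_T\in\mathbb R^n$ such that $\bar x_T\in\operatorname{ri}(\operatorname{dom}(g))$ and, for every $t\in\{1,\dots,T\}$, $\bar x_{t-1}\in\operatorname{ri}(X(t))$ and $\Delta\bar x_t\in\operatorname{ri}(\Gamma_L(t,\bar x_{t-1}))$. Then for every $\tau\in\{0,\dots,T\}$ one has $\vartheta_\tau^*=\omega_\tau$ on $\mathbb R^n$. Moreover, for every $\eta\in\operatorname{dom}(\omega_\tau)$ the infimum defining $\omega_\tau(\eta)$ is attained. -/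

import Mathlib

namespace Bolza

noncomputable section

/-- The state space `ℝⁿ` with its Euclidean structure. -/
abbrev Vec (n : ℕ) : Type := EuclideanSpace ℝ (Fin n)

/-- Effective domain of an extended-real-valued function. -/
def effDom {X : Type*} (φ : X → EReal) : Set X := {x | φ x < ⊤}

/-- Epigraph, as a subset of `X × ℝ`. -/
def epi {X : Type*} (φ : X → EReal) : Set (X × ℝ) := {q | φ q.1 ≤ (q.2 : EReal)}

/-- Proper: somewhere less than `+∞`, nowhere `-∞`. -/
def IsProper {X : Type*} (φ : X → EReal) : Prop := (effDom φ).Nonempty ∧ ∀ x, ⊥ < φ x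

/-- Proper, convex (convex epigraph) and lower semicontinuous. -/
structure IsProperConvexLsc {X : Type*} [AddCommGroup X] [Module ℝ X] [TopologicalSpace X]
    (φ : X → EReal) : Prop where
  proper : IsProper φ
  convex : Convex ℝ (epi φ)
  lsc : LowerSemicontinuous φ

/-- Convex conjugate on `ℝⁿ`. -/
def conjugate {n : ℕ} (φ : Vec n → EReal) (y : Vec n) : EReal :=
  ⨆ x : Vec n, ((inner ℝ x y : ℝ) : EReal) - φ x

/-- The dual Lagrangian `K_t(p, w) = sup_{x,v} { x·w + v·p - L_t(x, v) }`. -/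
def dualLagrangian {n : ℕ} (L : ℕ → Vec n × Vec n → EReal) (t : ℕ) (q : Vec n × Vec n) : EReal :=
  ⨆ z : Vec n × Vec n, ((inner ℝ z.1 q.2 + inner ℝ z.2 q.1 : ℝ) : EReal) - L t z

/-- The dual terminal cost `f(b) = g*(-b)`. -/
def dualTerminal {n : ℕ} (g : Vec n → EReal) (b : Vec n) : EReal := conjugate g (-b)

/-- The primal cost `∑_{t=τ+1}^T L_t(x_{t-1}, x_t - x_{t-1}) + g(x_T)`. A trajectory is given
as a sequence on `ℕ`, of which only the entries with indices in `[τ, T]` are used. -/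
def primalCost {n : ℕ} (T : ℕ) (L : ℕ → Vec n × Vec n → EReal) (g : Vec n → EReal)
    (τ : ℕ) (x : ℕ → Vec n) : EReal :=
  (∑ t ∈ Finset.Icc (τ + 1) T, L t (x (t - 1), x t - x (t - 1))) + g (x T)

/-- The dual cost `∑_{t=τ+1}^T K_t(p_t, p_t - p_{t-1}) + f(p_T)`. -/
def dualCost {n : ℕ} (T : ℕ) (L : ℕ → Vec n × Vec n → EReal) (g : Vec n → EReal)
    (τ : ℕ) (p : ℕ → Vec n) : EReal :=
  (∑ t ∈ Finset.Icc (τ + 1) T, dualLagrangian L t (p t, p t - p (t - 1))) +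
    dualTerminal g (p T)

/-- The primal value function `ϑ_τ`, for `τ ≤ T`. -/
def primalValue {n : ℕ} (T : ℕ) (L : ℕ → Vec n × Vec n → EReal) (g : Vec n → EReal)
    (τ : ℕ) (ξ : Vec n) : EReal :=
  ⨅ (x : ℕ → Vec n) (_ : x τ = ξ), primalCost T L g τ x

/-- The dual value function `ω_τ`, for `τ ≤ T`. -/
def dualValue {n : ℕ} (T : ℕ) (L : ℕ → Vec n × Vec n → EReal) (g : Vec n → EReal)
    (τ : ℕ) (η : Vec n) : EReal :=
  ⨅ (p : ℕ → Vec n) (_ : p τ = -η), dualCost T L g τ p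

/-- At the final time the primal value function is the terminal cost `g`. -/
theorem primalValue_final {n : ℕ} (T : ℕ) (L : ℕ → Vec n × Vec n → EReal) (g : Vec n → EReal)
    (ξ : Vec n) : primalValue T L g T ξ = g ξ := by
  apply le_antisymm
  · refine iInf₂_le_of_le (fun _ => ξ) rfl ?_
    simp [primalCost]
  · refine le_iInf₂ fun x hx => ?_
    simp [primalCost, hx]

/-- At the final time the dual value function is `η ↦ f(-η)`. -/
theorem dualValue_final {n : ℕ} (T : ℕ) (L : ℕ → Vec n × Vec n → EReal) (g : Vec n → EReal)
    (η : Vec n) : dualValue T L g T η = dualTerminal g (-η) := by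
  apply le_antisymm
  · refine iInf₂_le_of_le (fun _ => -η) rfl ?_
    simp [dualCost]
  · refine le_iInf₂ fun p hp => ?_
    simp [dualCost, hp]

/-- `Γ_L(t, x) = {v | L_t(x, v) ∈ ℝ}`. -/
def dynamicsSet {n : ℕ} (L : ℕ → Vec n × Vec n → EReal) (t : ℕ) (x : Vec n) : Set (Vec n) :=
  {v | ∃ r : ℝ, L t (x, v) = (r : EReal)}

/-- `X(t) = {x | Γ_L(t, x) ≠ ∅}`. -/
def stateSet {n : ℕ} (L : ℕ → Vec n × Vec n → EReal) (t : ℕ) : Set (Vec n) :=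
  {x | (dynamicsSet L t x).Nonempty}

/-- The strict feasibility (qualification) condition on the primal problem. -/
def PrimalStrictlyFeasible {n : ℕ} (T : ℕ) (L : ℕ → Vec n × Vec n → EReal)
    (g : Vec n → EReal) : Prop :=
  ∃ x : ℕ → Vec n, x T ∈ intrinsicInterior ℝ (effDom g) ∧
    ∀ t ∈ Finset.Icc 1 T, x (t - 1) ∈ intrinsicInterior ℝ (stateSet L t) ∧
      x t - x (t - 1) ∈ intrinsicInterior ℝ (dynamicsSet L t (x (t - 1)))

end

end Bolza

namespace Bolza

/-! Weak duality sums the Fenchel-Young inequalities of the stages along a primal and a dual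
trajectory: the inner products telescope (`inner_le_primalCost_add_dualCost`). The converse,
`exists_dualCost_le`, is a backward induction on `τ`. One stage maximizes `x·η - L(x, v) - ϑ(x +
v)`, with `ϑ` the next value function. A multiplier `p` for the coupling `y = x + v` splits a bound
`M` into a bound `N` on `K(p, p + η)` and a bound `M - N` on `ϑ*(-p)` (`exists_dual_split`); `p` is
the next dual state, and `-p` replaces `η`. The multipliers assemble into a minimizer, hence
attainment. Multipliers exist because (H) places the reference trajectory in the relative cores of
all the domains involved (`mem_relCore_costEpi`). -/

/-! ### Relative cores of convex sets -/

/-- The algebraic relative interior of a set: every segment of the set that ends at `x` can be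
prolonged beyond `x` inside the set. -/
def relCore {E : Type*} [AddCommGroup E] [Module ℝ E] (C : Set E) : Set E :=
  {x | x ∈ C ∧ ∀ y ∈ C, ∃ ε : ℝ, 0 < ε ∧ x + ε • (x - y) ∈ C}

theorem intrinsicInterior_subset_relCore {E : Type*} [NormedAddCommGroup E] [NormedSpace ℝ E]
    (C : Set E) : intrinsicInterior ℝ C ⊆ relCore C := by
  intro x hx
  refine ⟨intrinsicInterior_subset hx, fun y hy => ?_⟩
  obtain ⟨x', hx', rfl⟩ := mem_intrinsicInterior.1 hx
  have hmem : ∀ ε : ℝ, (x' : E) + ε • ((x' : E) - y) ∈ affineSpan ℝ C := fun ε => by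
    have h := AffineMap.lineMap_mem (-ε) x'.2 (subset_affineSpan ℝ C hy)
    rw [AffineMap.lineMap_apply_module'] at h
    convert h using 1
    module
  let c : ℝ → affineSpan ℝ C := fun ε => ⟨(x' : E) + ε • ((x' : E) - y), hmem ε⟩
  have hc : Continuous c := Continuous.subtype_mk (by fun_prop) _
  have hc0 : c 0 = x' := by ext; simp [c]
  have hev : ∀ᶠ ε in nhds (0 : ℝ), c ε ∈ ((↑) ⁻¹' C : Set (affineSpan ℝ C)) := by
    apply hc.continuousAt.eventually
    rw [hc0]
    exact mem_interior_iff_mem_nhds.1 hx'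
  obtain ⟨ε, h1, h2⟩ :=
    ((hev.filter_mono nhdsWithin_le_nhds).and
      (self_mem_nhdsWithin : Set.Ioi (0 : ℝ) ∈ nhdsWithin 0 (Set.Ioi 0))).exists
  exact ⟨ε, h2, h1⟩

theorem exists_prolong_of_mem_relCore {E : Type*} [AddCommGroup E] [Module ℝ E] {C : Set E}
    (hC : Convex ℝ C) {x y : E} (hx : x ∈ relCore C) (hy : y ∈ C) :
    ∃ ε : ℝ, 0 < ε ∧ ∀ δ, 0 < δ → δ ≤ ε → x + δ • (x - y) ∈ C := by
  obtain ⟨ε, hε, h⟩ := hx.2 y hy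
  refine ⟨ε, hε, fun δ hδ hle => ?_⟩
  have := hC.add_smul_sub_mem hx.1 h (t := δ / ε) ⟨by positivity, (div_le_one hε).2 hle⟩
  rw [add_sub_cancel_left, smul_smul, div_mul_cancel₀ _ hε.ne'] at this
  exact this

/-- A point of the relative core of the projection of a convex set, completed by a point of the
relative core of the fibre above it, lies in the relative core of the set. -/
theorem prodMk_mem_relCore {E F : Type*} [AddCommGroup E] [Module ℝ E] [AddCommGroup F]
    [Module ℝ F] {D : Set (E × F)} (hD : Convex ℝ D) {x : E} {v : F}
    (hx : x ∈ relCore (Prod.fst '' D)) (hv : v ∈ relCore {w | (x, w) ∈ D}) :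
    (x, v) ∈ relCore D := by
  refine ⟨hv.1, ?_⟩
  rintro ⟨y, w⟩ hyw
  obtain ⟨ε, hε, ⟨⟨x', v'⟩, hxv', hx'⟩⟩ := hx.2 y ⟨_, hyw, rfl⟩
  simp only at hx'
  subst hx'
  -- The segment from `(y, w)` to `(x', v')` crosses the fibre over `x` at `v''`.
  set v'' : F := (ε / (1 + ε)) • w + (1 / (1 + ε)) • v' with hv''
  have h1 : (x, v'') ∈ D := by
    have := hD hyw hxv' (a := ε / (1 + ε)) (b := 1 / (1 + ε)) (by positivity) (by positivity)
      (by field_simp; ring)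
    convert this using 1
    ext1
    · simp only [Prod.fst_add, Prod.smul_fst]
      match_scalars <;> field_simp <;> ring
    · simp [hv'']
  obtain ⟨δ, hδ, h2⟩ := hv.2 v'' h1
  simp only [Set.mem_ofPred_eq] at h2
  -- `(x, v)` is a convex combination of `(y, w)` and two other points of `D`, with positive weights
  refine ⟨δ * ε / (1 + δ + ε), by positivity, ?_⟩
  have := hD h2 hxv' (a := (1 + ε) / (1 + δ + ε)) (b := δ / (1 + δ + ε)) (by positivity)
    (by positivity) (by field_simp; ring)
  convert this using 1
  ext1
  · simp only [Prod.fst_add, Prod.smul_fst, Prod.fst_sub]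
    match_scalars <;> field_simp <;> ring
  · simp only [Prod.snd_add, Prod.smul_snd, Prod.snd_sub, hv'']
    match_scalars <;> field_simp <;> ring

/-- The subspace spanned by a convex set having the origin in its relative core. -/
def relCoreSpan {V : Type*} [AddCommGroup V] [Module ℝ V] (D : Set V) (hD : Convex ℝ D)
    (h0 : (0 : V) ∈ relCore D) : Submodule ℝ V where
  carrier := {u | ∃ c : ℝ, 0 < c ∧ c • u ∈ D}
  zero_mem' := ⟨1, one_pos, by simpa using h0.1⟩
  add_mem' := by
    rintro u v ⟨c, hc, hu⟩ ⟨d, hd, hv⟩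
    refine ⟨c * d / (c + d), by positivity, ?_⟩
    have := hD hu hv (a := d / (c + d)) (b := c / (c + d)) (by positivity) (by positivity)
      (by field_simp; ring)
    convert this using 1
    match_scalars <;> field_simp
  smul_mem' := by
    rintro a u ⟨c, hc, hu⟩
    rcases lt_trichotomy a 0 with ha | rfl | ha
    -- Negative multiples come from prolonging the segment from `c • u` beyond the origin.
    · obtain ⟨ε, hε, h⟩ := h0.2 _ hu
      refine ⟨ε * c / (-a), div_pos (by positivity) (by linarith), ?_⟩
      convert h using 1
      have := ha.ne
      match_scalars
      field_simp
    · exact ⟨1, one_pos, by simpa using h0.1⟩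
    · refine ⟨c / a, by positivity, ?_⟩
      rwa [smul_smul, div_mul_cancel₀ _ (ne_of_gt ha)]

/-! ### Lagrange multipliers by extension of positive functionals -/

/-- A convex cone with the origin added. -/
def coneWithZero {E : Type*} [AddCommGroup E] [Module ℝ E] (K : ConvexCone ℝ E) :
    PointedCone ℝ E where
  carrier := {x | x = 0 ∨ x ∈ K}
  zero_mem' := Or.inl rfl
  add_mem' := by
    rintro x y (rfl | hx) (rfl | hy)
    · simp
    · simpa using Or.inr hy
    · simpa using Or.inr hx
    · exact Or.inr (K.add_mem hx hy)
  smul_mem' := by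
    rintro ⟨c, hc⟩ x (rfl | hx)
    · exact Or.inl (smul_zero _)
    · rcases hc.eq_or_lt with rfl | hc
      · exact Or.inl (zero_smul ℝ x)
      · exact Or.inr (K.smul_mem hc hx)

/-- Existence of a Lagrange multiplier: a convex set in `V × ℝ` that lies above the height `m` over
the origin lies above the graph of an affine function of value `m` at the origin, provided the
origin is in the relative core of its projection. -/
theorem exists_multiplier {V : Type*} [AddCommGroup V] [Module ℝ V] {C : Set (V × ℝ)}
    (hC : Convex ℝ C) (h0 : (0 : V) ∈ relCore (Prod.fst '' C)) {m : ℝ}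
    (hm : ∀ r, ((0 : V), r) ∈ C → m ≤ r) :
    ∃ p : V →ₗ[ℝ] ℝ, ∀ z ∈ C, m + p z.1 ≤ z.2 := by
  have hD : Convex ℝ (Prod.fst '' C) := hC.linear_image (LinearMap.fst ℝ V ℝ)
  -- Within `W` every vector scales into the projection of `C`, which is the cofinality that
  -- `riesz_extension` requires.
  let W := relCoreSpan _ hD h0
  let S : Set (W × ℝ) := {q | ((q.1 : V), m + q.2) ∈ C}
  have hS : Convex ℝ S := by
    rintro ⟨w, s⟩ hw ⟨w', s'⟩ hw' a b ha hb hab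
    have := hC hw hw' ha hb hab
    simp only [S, Set.mem_ofPred_eq] at this ⊢
    convert this using 1
    ext1
    · simp
    · simp only [Prod.snd_add, Prod.smul_snd, smul_eq_mul]
      linear_combination (-m) * hab
  -- The height on the vertical axis; `hm` makes it nonnegative on the cone over `S`.
  let f : (W × ℝ) →ₗ.[ℝ] ℝ :=
    ⟨Submodule.prod ⊥ ⊤, (LinearMap.snd ℝ W ℝ).comp (Submodule.subtype _)⟩
  obtain ⟨φ, hφ, hφS⟩ := riesz_extension (coneWithZero (ConvexCone.hull ℝ S)) f (by
    rintro ⟨⟨w, s⟩, hw⟩ hmem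
    have hw0 : w = 0 := (Submodule.mem_bot ℝ).1 hw.1
    subst hw0
    change 0 ≤ s
    rcases hmem with hmem | hmem
    · exact (congrArg Prod.snd hmem).ge
    obtain ⟨c, hc, ⟨w', t⟩, hy, hcy⟩ := (ConvexCone.mem_hull_of_convex hS).1 hmem
    simp only [Prod.smul_mk, Prod.mk.injEq, smul_eq_mul] at hcy
    obtain ⟨h1, h2⟩ := hcy
    have hw' : w' = 0 := (smul_eq_zero.1 h1).resolve_left hc.ne'
    subst hw'
    have ht := hm (m + t) hy
    rw [← h2]
    exact mul_nonneg hc.le (by linarith)) (by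
    rintro ⟨w, r⟩
    obtain ⟨c, hc, ⟨z, hz, hzc⟩⟩ := w.2
    -- This vertical shift moves `(w, r)` onto `c⁻¹` times a point of `S`.
    refine ⟨⟨(0, c⁻¹ * (z.2 - m) - r), ⟨by simp, trivial⟩⟩, ?_⟩
    refine Or.inr <| (ConvexCone.mem_hull_of_convex hS).2 ⟨c⁻¹, by positivity, (c • w, z.2 - m), ?_, ?_⟩
    · change ((↑(c • w) : V), m + (z.2 - m)) ∈ C
      rw [add_sub_cancel, Submodule.coe_smul, ← hzc]
      exact hz
    · ext1
      · simp [smul_smul, inv_mul_cancel₀ hc.ne']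
      · simp)
  -- Any extension to `V` will do, since `C` projects into `W`.
  obtain ⟨p, hp⟩ := LinearMap.exists_extend (-(φ.comp (LinearMap.inl ℝ W ℝ)))
  refine ⟨p, ?_⟩
  rintro ⟨u, r⟩ hz
  have hu : u ∈ W := ⟨1, one_pos, (u, r), hz, by simp⟩
  have h1 : p u = -φ (⟨u, hu⟩, 0) := LinearMap.congr_fun hp ⟨u, hu⟩
  have h2 : φ ((0 : W), r - m) = r - m := hφ ⟨((0 : W), r - m), ⟨by simp, trivial⟩⟩
  have h3 : 0 ≤ φ (⟨u, hu⟩, r - m) := by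
    refine hφS _ (Or.inr (ConvexCone.subset_hull ?_))
    change (u, m + (r - m)) ∈ C
    rwa [add_sub_cancel]
  have h4 : φ (⟨u, hu⟩, r - m) = φ (⟨u, hu⟩, 0) + φ (0, r - m) := by
    rw [← map_add]; simp
  simp only
  linarith

/-! ### Extended-real arithmetic through real upper bounds -/

theorem image_fst_epi {X : Type*} (φ : X → EReal) : Prod.fst '' epi φ = effDom φ := by
  ext x
  constructor
  · rintro ⟨⟨y, r⟩, h, rfl⟩
    exact lt_of_le_of_lt h (EReal.coe_lt_top r)
  · intro h
    exact ⟨(x, (φ x).toReal), EReal.le_coe_toReal h.ne, rfl⟩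

theorem coe_sub_le_coe_of_forall {a c : ℝ} {e : EReal} (he : ⊥ < e)
    (h : ∀ r : ℝ, e ≤ r → a - r ≤ c) : (a : EReal) - e ≤ c := by
  induction e with
  | bot => exact absurd he (lt_irrefl _)
  | top => simp
  | coe r => exact_mod_cast h r le_rfl

theorem bot_lt_coe_sub {a : ℝ} {e : EReal} (he : e < ⊤) : ⊥ < (a : EReal) - e := by
  induction e with
  | bot => simp
  | top => exact absurd he (lt_irrefl _)
  | coe r => exact EReal.bot_lt_coe (a - r)

theorem coe_le_add_of_coe_sub_le {a : ℝ} {b c : EReal} (hb : ⊥ < b) (hc : ⊥ < c)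
    (h : (a : EReal) - b ≤ c) : (a : EReal) ≤ b + c := by
  rw [add_comm]
  exact (EReal.sub_le_iff_le_add (Or.inl hb.ne') (Or.inr hc.ne')).1 h

theorem exists_coe_add_coe_eq_of_add_le {a b : EReal} {r : ℝ} (ha : ⊥ < a) (hb : ⊥ < b)
    (h : a + b ≤ r) : ∃ s t : ℝ, a ≤ s ∧ b ≤ t ∧ s + t = r := by
  induction a with
  | bot => exact absurd ha (lt_irrefl _)
  | top => rw [EReal.top_add_of_ne_bot hb.ne'] at h; exact absurd h (by simp)
  | coe s =>
    refine ⟨s, r - s, le_rfl, ?_, by ring⟩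
    induction b with
    | bot => exact bot_le
    | top => rw [EReal.coe_add_top] at h; exact absurd h (by simp)
    | coe t =>
      have h' : s + t ≤ r := by exact_mod_cast h
      exact_mod_cast (by linarith : t ≤ r - s)

/-! ### One-stage Fenchel duality -/

/-- Fenchel duality for the problem of maximizing `⟪x, η⟫ - r - s` over the `((x, v), r) ∈ A` and
`(x + v, s) ∈ B`, where `A` and `B` are convex: an upper bound of the problem splits into upper
bounds of two independent problems. -/
theorem exists_dual_split {n : ℕ} {A : Set ((Vec n × Vec n) × ℝ)} {B : Set (Vec n × ℝ)}
    (hA : Convex ℝ A) (hB : Convex ℝ B) {z : Vec n × Vec n}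
    (hz : z ∈ relCore (Prod.fst '' A)) (hy : z.1 + z.2 ∈ relCore (Prod.fst '' B))
    {η : Vec n} {M : ℝ}
    (h : ∀ a ∈ A, ∀ b ∈ B, b.1 = a.1.1 + a.1.2 → inner ℝ a.1.1 η - a.2 - b.2 ≤ M) :
    ∃ (p : Vec n) (N : ℝ),
      (∀ a ∈ A, inner ℝ a.1.1 (p + η) + inner ℝ a.1.2 p - a.2 ≤ N) ∧
      ∀ b ∈ B, inner ℝ b.1 (-p) - b.2 ≤ M - N := by
  -- First component: the defect in the coupling. Second: the objective to be minimized.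
  let Φ : ((Vec n × Vec n) × ℝ) × (Vec n × ℝ) →ₗ[ℝ] Vec n × ℝ :=
    { toFun := fun q => (q.2.1 - (q.1.1.1 + q.1.1.2), q.1.2 + q.2.2 - inner ℝ q.1.1.1 η)
      map_add' := fun q q' => by
        ext1
        · simp only [Prod.fst_add, Prod.snd_add]; abel
        · simp only [Prod.fst_add, Prod.snd_add, inner_add_left]; ring
      map_smul' := fun c q => by
        ext1
        · simp only [Prod.smul_fst, Prod.smul_snd, RingHom.id_apply, smul_sub, smul_add]
        · simp only [Prod.smul_fst, Prod.smul_snd, RingHom.id_apply, real_inner_smul_left,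
            smul_eq_mul]
          ring }
  have hC : Convex ℝ (Φ '' (A ×ˢ B)) := (hA.prod hB).linear_image Φ
  have hdA : Convex ℝ (Prod.fst '' A) := hA.linear_image (LinearMap.fst ℝ _ _)
  have hdB : Convex ℝ (Prod.fst '' B) := hB.linear_image (LinearMap.fst ℝ _ _)
  have h0 : (0 : Vec n) ∈ relCore (Prod.fst '' (Φ '' (A ×ˢ B))) := by
    constructor
    · obtain ⟨a, ha, rfl⟩ := hz.1
      obtain ⟨b, hb, hba⟩ := hy.1
      exact ⟨_, ⟨(a, b), ⟨ha, hb⟩, rfl⟩, by simp [Φ, hba]⟩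
    · rintro _ ⟨_, ⟨⟨a, b⟩, ⟨ha, hb⟩, rfl⟩, rfl⟩
      obtain ⟨ε, hε, hεA⟩ := exists_prolong_of_mem_relCore hdA hz ⟨a, ha, rfl⟩
      obtain ⟨δ, hδ, hδB⟩ := exists_prolong_of_mem_relCore hdB hy ⟨b, hb, rfl⟩
      have hpos : 0 < min ε δ := lt_min hε hδ
      obtain ⟨a', ha', haeq⟩ := hεA _ hpos (min_le_left _ _)
      obtain ⟨b', hb', hbeq⟩ := hδB _ hpos (min_le_right _ _)
      refine ⟨min ε δ, hpos, _, ⟨(a', b'), ⟨ha', hb'⟩, rfl⟩, ?_⟩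
      simp only [Φ, LinearMap.coe_mk, AddHom.coe_mk, haeq, hbeq, Prod.fst_add, Prod.snd_add,
        Prod.smul_fst, Prod.smul_snd, Prod.fst_sub, Prod.snd_sub]
      module
  obtain ⟨q, hq⟩ := exists_multiplier hC h0 (m := -M) (by
    rintro r ⟨⟨a, b⟩, ⟨ha, hb⟩, hr⟩
    obtain ⟨h1, h2⟩ := Prod.mk.inj hr
    have := h a ha b hb (sub_eq_zero.1 h1)
    simp only at h2
    linarith)
  set p : Vec n := -(InnerProductSpace.toDual ℝ (Vec n)).symm (LinearMap.toContinuousLinearMap q)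
    with hp
  have hqp : ∀ u, q u = -inner ℝ u p := fun u => by
    rw [hp, inner_neg_right, neg_neg, real_inner_comm, InnerProductSpace.toDual_symm_apply]
    rfl
  have key : ∀ a ∈ A, ∀ b ∈ B, inner ℝ a.1.1 (p + η) + inner ℝ a.1.2 p - a.2 ≤
      M - (inner ℝ b.1 (-p) - b.2) := fun a ha b hb => by
    have := hq _ ⟨(a, b), ⟨ha, hb⟩, rfl⟩
    simp only [Φ, LinearMap.coe_mk, AddHom.coe_mk, hqp, inner_sub_left, inner_add_left] at this
    have h1 := inner_add_right (𝕜 := ℝ) a.1.1 p η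
    have h2 := inner_neg_right (𝕜 := ℝ) b.1 p
    linarith
  obtain ⟨⟨a₀, ha₀, -⟩, -⟩ := hz
  obtain ⟨⟨b₀, hb₀, -⟩, -⟩ := hy
  -- In `key` the variables `a` and `b` are decoupled, so a single real `N` separates the two sides.
  obtain ⟨N, hN₁, hN₂⟩ := exists_between_of_forall_le
    (s := (fun a : (Vec n × Vec n) × ℝ => inner ℝ a.1.1 (p + η) + inner ℝ a.1.2 p - a.2) '' A)
    (t := (fun b : Vec n × ℝ => M - (inner ℝ b.1 (-p) - b.2)) '' B)
    ⟨_, a₀, ha₀, rfl⟩ ⟨_, b₀, hb₀, rfl⟩ (by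
      rintro _ ⟨a, ha, rfl⟩ _ ⟨b, hb, rfl⟩
      exact key a ha b hb)
  refine ⟨p, N, fun a ha => hN₁ ⟨a, ha, rfl⟩, fun b hb => ?_⟩
  have := hN₂ ⟨b, hb, rfl⟩
  simp only at this
  linarith

/-! ### Stagewise recursion and duality for trajectories -/

section Costs

variable {n : ℕ} {T : ℕ} {L : ℕ → Vec n × Vec n → EReal} {g : Vec n → EReal}

theorem primalCost_of_lt {τ : ℕ} (h : τ < T) (x : ℕ → Vec n) :
    primalCost T L g τ x = L (τ + 1) (x τ, x (τ + 1) - x τ) + primalCost T L g (τ + 1) x := by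
  rw [primalCost, primalCost, ← Finset.insert_Icc_add_one_left_eq_Icc (Nat.succ_le_of_lt h),
    Finset.sum_insert (by simp), add_assoc]
  rfl

theorem dualCost_of_lt {τ : ℕ} (h : τ < T) (p : ℕ → Vec n) :
    dualCost T L g τ p = dualLagrangian L (τ + 1) (p (τ + 1), p (τ + 1) - p τ) +
      dualCost T L g (τ + 1) p := by
  rw [dualCost, dualCost, ← Finset.insert_Icc_add_one_left_eq_Icc (Nat.succ_le_of_lt h),
    Finset.sum_insert (by simp), add_assoc]
  rfl

theorem primalCost_congr {τ : ℕ} (hτ : τ ≤ T) {x y : ℕ → Vec n} (h : ∀ t, τ ≤ t → x t = y t) :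
    primalCost T L g τ x = primalCost T L g τ y := by
  rw [primalCost, primalCost, h T hτ]
  congr 1
  refine Finset.sum_congr rfl fun t ht => ?_
  have := (Finset.mem_Icc.1 ht).1
  rw [h t (by omega), h (t - 1) (by omega)]

theorem dualCost_congr {τ : ℕ} (hτ : τ ≤ T) {p q : ℕ → Vec n} (h : ∀ t, τ ≤ t → p t = q t) :
    dualCost T L g τ p = dualCost T L g τ q := by
  rw [dualCost, dualCost, h T hτ]
  congr 1
  refine Finset.sum_congr rfl fun t ht => ?_
  have := (Finset.mem_Icc.1 ht).1
  rw [h t (by omega), h (t - 1) (by omega)]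

theorem bot_lt_conjugate {φ : Vec n → EReal} (h : (effDom φ).Nonempty) (y : Vec n) :
    ⊥ < conjugate φ y := by
  obtain ⟨x, hx⟩ := h
  refine lt_of_lt_of_le ?_ (le_iSup (fun x : Vec n => ((inner ℝ x y : ℝ) : EReal) - φ x) x)
  exact bot_lt_coe_sub hx

theorem bot_lt_dualLagrangian {t : ℕ} (h : (effDom (L t)).Nonempty) (q : Vec n × Vec n) :
    ⊥ < dualLagrangian L t q := by
  obtain ⟨z, hz⟩ := h
  refine lt_of_lt_of_le ?_ (le_iSup (fun z : Vec n × Vec n =>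
    ((inner ℝ z.1 q.2 + inner ℝ z.2 q.1 : ℝ) : EReal) - L t z) z)
  exact bot_lt_coe_sub hz

theorem bot_lt_primalCost (hL : ∀ t ∈ Finset.Icc 1 T, IsProper (L t)) (hg : IsProper g)
    {τ : ℕ} (hτ : τ ≤ T) (x : ℕ → Vec n) : ⊥ < primalCost T L g τ x := by
  induction hτ using Nat.decreasingInduction with
  | self => simpa [primalCost] using hg.2 _
  | of_succ k hk ih =>
    rw [primalCost_of_lt hk, EReal.bot_lt_add_iff]
    exact ⟨(hL _ (Finset.mem_Icc.2 (by omega))).2 _, ih⟩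

theorem bot_lt_dualCost (hL : ∀ t ∈ Finset.Icc 1 T, IsProper (L t)) (hg : IsProper g)
    {τ : ℕ} (hτ : τ ≤ T) (p : ℕ → Vec n) : ⊥ < dualCost T L g τ p := by
  induction hτ using Nat.decreasingInduction with
  | self => simpa [dualCost, dualTerminal] using bot_lt_conjugate hg.1 _
  | of_succ k hk ih =>
    rw [dualCost_of_lt hk, EReal.bot_lt_add_iff]
    exact ⟨bot_lt_dualLagrangian (hL _ (Finset.mem_Icc.2 (by omega))).1 _, ih⟩

/-- Weak duality between trajectories. -/
theorem inner_le_primalCost_add_dualCost (hL : ∀ t ∈ Finset.Icc 1 T, IsProper (L t))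
    (hg : IsProper g) {τ : ℕ} (hτ : τ ≤ T) (x p : ℕ → Vec n) :
    ((inner ℝ (x τ) (-p τ) : ℝ) : EReal) ≤ primalCost T L g τ x + dualCost T L g τ p := by
  induction hτ using Nat.decreasingInduction with
  | self =>
    simp only [primalCost, dualCost, Finset.Icc_eq_empty_of_lt (Nat.lt_succ_self T),
      Finset.sum_empty, zero_add, dualTerminal]
    exact coe_le_add_of_coe_sub_le (hg.2 _) (bot_lt_conjugate hg.1 _)
      (le_iSup (fun y : Vec n => ((inner ℝ y (-p T) : ℝ) : EReal) - g y) (x T))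
  | of_succ k hk ih =>
    have hLk := hL (k + 1) (Finset.mem_Icc.2 (by omega))
    have h1 : ((inner ℝ (x k) (p (k + 1) - p k) + inner ℝ (x (k + 1) - x k) (p (k + 1)) : ℝ) :
        EReal) ≤ L (k + 1) (x k, x (k + 1) - x k) +
          dualLagrangian L (k + 1) (p (k + 1), p (k + 1) - p k) :=
      coe_le_add_of_coe_sub_le (hLk.2 _) (bot_lt_dualLagrangian hLk.1 _)
        (le_iSup (fun z : Vec n × Vec n => ((inner ℝ z.1 (p (k + 1) - p k) +
          inner ℝ z.2 (p (k + 1)) : ℝ) : EReal) - L (k + 1) z) (x k, x (k + 1) - x k))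
    rw [primalCost_of_lt hk, dualCost_of_lt hk, add_add_add_comm]
    -- Telescoping: `x_k·Δp + Δx·p_{k+1} - x_{k+1}·p_{k+1} = -x_k·p_k`, with `Δ` the increments from
    -- `k` to `k + 1`.
    refine le_trans (le_of_eq ?_) (add_le_add h1 ih)
    rw [← EReal.coe_add]
    congr 1
    simp only [inner_sub_right, inner_sub_left, inner_neg_right]
    ring

/-- The pairs of an initial state and an upper bound of the cost of some trajectory issued from
it. -/
def costEpi (T : ℕ) (L : ℕ → Vec n × Vec n → EReal) (g : Vec n → EReal) (τ : ℕ) :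
    Set (Vec n × ℝ) :=
  {q | ∃ x : ℕ → Vec n, x τ = q.1 ∧ primalCost T L g τ x ≤ (q.2 : EReal)}

theorem costEpi_final : costEpi T L g T = epi g := by
  ext ⟨ξ, r⟩
  constructor
  · rintro ⟨x, hx, h⟩
    simpa [primalCost, epi, hx] using h
  · intro h
    exact ⟨fun _ => ξ, rfl, by simpa [primalCost, epi] using h⟩

/-- Dynamic programming for bounds reached by actual trajectories: with no infimum taken, neither
attainment nor the value `-∞` matters. -/
theorem mem_costEpi_of_lt (hL : ∀ t ∈ Finset.Icc 1 T, IsProper (L t)) (hg : IsProper g)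
    {τ : ℕ} (h : τ < T) {ξ : Vec n} {r : ℝ} :
    (ξ, r) ∈ costEpi T L g τ ↔ ∃ (v : Vec n) (s t : ℝ), ((ξ, v), s) ∈ epi (L (τ + 1)) ∧
      (ξ + v, t) ∈ costEpi T L g (τ + 1) ∧ s + t = r := by
  constructor
  · rintro ⟨x, rfl, hx⟩
    simp only at hx
    rw [primalCost_of_lt h] at hx
    obtain ⟨s, t, hs, ht, hst⟩ := exists_coe_add_coe_eq_of_add_le
      ((hL (τ + 1) (Finset.mem_Icc.2 (by omega))).2 _) (bot_lt_primalCost hL hg h x) hx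
    exact ⟨x (τ + 1) - x τ, s, t, hs, ⟨x, by simp, ht⟩, hst⟩
  · rintro ⟨v, s, t, hs, ⟨x, hx, ht⟩, rfl⟩
    refine ⟨Function.update x τ ξ, by simp, ?_⟩
    simp only at hx
    rw [primalCost_of_lt h, primalCost_congr (y := x) h fun t ht =>
      Function.update_of_ne (by omega) _ _]
    simp only [Function.update_self, Function.update_of_ne (Nat.succ_ne_self τ), hx,
      add_sub_cancel_left, EReal.coe_add]
    exact add_le_add hs ht

theorem convex_costEpi (hL : ∀ t ∈ Finset.Icc 1 T, IsProper (L t)) (hg : IsProper g)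
    (hLc : ∀ t ∈ Finset.Icc 1 T, Convex ℝ (epi (L t))) (hgc : Convex ℝ (epi g))
    {τ : ℕ} (hτ : τ ≤ T) : Convex ℝ (costEpi T L g τ) := by
  induction hτ using Nat.decreasingInduction with
  | self => rwa [costEpi_final]
  | of_succ k hk ih =>
    rintro ⟨ξ, r⟩ h ⟨ξ', r'⟩ h' a b ha hb hab
    obtain ⟨v, s, t, hs, ht, rfl⟩ := (mem_costEpi_of_lt hL hg hk).1 h
    obtain ⟨v', s', t', hs', ht', rfl⟩ := (mem_costEpi_of_lt hL hg hk).1 h'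
    refine (mem_costEpi_of_lt hL hg hk).2 ⟨a • v + b • v', a * s + b * s', a * t + b * t',
      hLc _ (Finset.mem_Icc.2 (by omega)) hs hs' ha hb hab, ?_, ?_⟩
    · convert ih ht ht' ha hb hab using 1
      ext1
      · simp only [Prod.fst_add, Prod.smul_fst]; module
      · simp
    · change a * s + b * s' + (a * t + b * t') = a * (s + t) + b * (s' + t')
      ring

/-- The coupling `y = x + v` is linear, so prolonging the stage pair and the next state by a common
step preserves it. -/
theorem mem_relCore_costEpi (hL : ∀ t ∈ Finset.Icc 1 T, IsProper (L t)) (hg : IsProper g)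
    (hLc : ∀ t ∈ Finset.Icc 1 T, Convex ℝ (epi (L t))) (hgc : Convex ℝ (epi g))
    {x : ℕ → Vec n} (hxT : x T ∈ relCore (effDom g))
    (hx : ∀ t ∈ Finset.Icc 1 T, (x (t - 1), x t - x (t - 1)) ∈ relCore (effDom (L t)))
    {τ : ℕ} (hτ : τ ≤ T) : x τ ∈ relCore (Prod.fst '' costEpi T L g τ) := by
  induction hτ using Nat.decreasingInduction with
  | self => rwa [costEpi_final, image_fst_epi]
  | of_succ k hk ih =>
    have hmem : k + 1 ∈ Finset.Icc 1 T := Finset.mem_Icc.2 (by omega)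
    have hdA : Convex ℝ (Prod.fst '' epi (L (k + 1))) :=
      (hLc _ hmem).linear_image (LinearMap.fst ℝ _ _)
    have hdB : Convex ℝ (Prod.fst '' costEpi T L g (k + 1)) :=
      (convex_costEpi hL hg hLc hgc hk).linear_image (LinearMap.fst ℝ _ _)
    have hxk := hx _ hmem
    rw [← image_fst_epi, Nat.add_sub_cancel] at hxk
    constructor
    · obtain ⟨⟨z, s⟩, hs, hz⟩ := hxk.1
      obtain ⟨⟨y, t⟩, ht, hy⟩ := ih.1
      simp only at hz hy
      subst hz hy
      exact ⟨(x k, s + t), (mem_costEpi_of_lt hL hg hk).2 ⟨_, s, t, hs, by simpa using ht, rfl⟩,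
        rfl⟩
    · rintro _ ⟨⟨ξ, r⟩, h, rfl⟩
      obtain ⟨v, s, t, hs, ht, rfl⟩ := (mem_costEpi_of_lt hL hg hk).1 h
      obtain ⟨ε, hε, hεA⟩ := exists_prolong_of_mem_relCore hdA hxk ⟨_, hs, rfl⟩
      obtain ⟨δ, hδ, hδB⟩ := exists_prolong_of_mem_relCore hdB ih ⟨_, ht, rfl⟩
      have hpos : 0 < min ε δ := lt_min hε hδ
      obtain ⟨⟨⟨z, w⟩, s'⟩, hs', hz⟩ := hεA _ hpos (min_le_left _ _)
      obtain ⟨⟨y, t'⟩, ht', hy⟩ := hδB _ hpos (min_le_right _ _)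
      obtain ⟨hz1, hz2⟩ := Prod.mk.inj hz
      simp only at hz1 hz2 hy
      refine ⟨min ε δ, hpos, (z, s' + t'),
        (mem_costEpi_of_lt hL hg hk).2 ⟨w, s', t', hs', ?_, rfl⟩, hz1⟩
      convert ht' using 2
      rw [hz1, hz2, hy]
      simp only [Prod.fst_sub, Prod.snd_sub, Prod.smul_fst, Prod.smul_snd]
      module

/-- Strong duality: an upper bound of the primal problem is attained by a dual trajectory. -/
theorem exists_dualCost_le (hL : ∀ t ∈ Finset.Icc 1 T, IsProper (L t)) (hg : IsProper g)
    (hLc : ∀ t ∈ Finset.Icc 1 T, Convex ℝ (epi (L t))) (hgc : Convex ℝ (epi g))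
    {x : ℕ → Vec n} (hxT : x T ∈ relCore (effDom g))
    (hx : ∀ t ∈ Finset.Icc 1 T, (x (t - 1), x t - x (t - 1)) ∈ relCore (effDom (L t)))
    {τ : ℕ} (hτ : τ ≤ T) : ∀ (η : Vec n) (M : ℝ),
      (∀ q ∈ costEpi T L g τ, inner ℝ q.1 η - q.2 ≤ M) →
      ∃ p : ℕ → Vec n, p τ = -η ∧ dualCost T L g τ p ≤ M := by
  induction hτ using Nat.decreasingInduction with
  | self =>
    intro η M h
    rw [costEpi_final] at h
    refine ⟨fun _ => -η, rfl, ?_⟩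
    simp only [dualCost, Finset.Icc_eq_empty_of_lt (Nat.lt_succ_self T), Finset.sum_empty,
      zero_add, dualTerminal, neg_neg]
    exact iSup_le fun y => coe_sub_le_coe_of_forall (hg.2 y) fun r hr => h (y, r) hr
  | of_succ k hk ih =>
    intro η M h
    have hmem : k + 1 ∈ Finset.Icc 1 T := Finset.mem_Icc.2 (by omega)
    have hxk := hx _ hmem
    rw [← image_fst_epi, Nat.add_sub_cancel] at hxk
    obtain ⟨p, N, h1, h2⟩ := exists_dual_split (hLc _ hmem) (convex_costEpi hL hg hLc hgc hk) hxk
      (by simpa using mem_relCore_costEpi hL hg hLc hgc hxT hx hk) (η := η) (M := M) (by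
        rintro ⟨⟨y, v⟩, s⟩ ha ⟨_, t⟩ hb rfl
        have := h (y, s + t) ((mem_costEpi_of_lt hL hg hk).2 ⟨v, s, t, ha, hb, rfl⟩)
        simp only at this ⊢
        linarith)
    obtain ⟨q, hq, hqM⟩ := ih (-p) (M - N) h2
    -- Here `q (k + 1) = p`, so the first increment is `p + η`.
    refine ⟨Function.update q k (-η), by simp, ?_⟩
    rw [dualCost_of_lt hk, dualCost_congr (q := q) hk fun t ht =>
      Function.update_of_ne (by omega) _ _]
    simp only [Function.update_self, Function.update_of_ne (Nat.succ_ne_self k), hq, neg_neg,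
      sub_neg_eq_add]
    have h3 : dualLagrangian L (k + 1) (p, p + η) ≤ N :=
      iSup_le fun z => coe_sub_le_coe_of_forall ((hL _ hmem).2 z) fun r hr => h1 (z, r) hr
    refine (add_le_add h3 hqM).trans (le_of_eq ?_)
    rw [← EReal.coe_add, add_sub_cancel]

/-- By properness, `stateSet` is the projection of the domain and `dynamicsSet` its fibre, so
`prodMk_mem_relCore` applies. -/
theorem mem_relCore_effDom_of_mem_intrinsicInterior {t : ℕ} (hL : IsProper (L t))
    (hLc : Convex ℝ (epi (L t))) {x v : Vec n}
    (hx : x ∈ intrinsicInterior ℝ (stateSet L t))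
    (hv : v ∈ intrinsicInterior ℝ (dynamicsSet L t x)) : (x, v) ∈ relCore (effDom (L t)) := by
  have hdyn : ∀ y, dynamicsSet L t y = {w | (y, w) ∈ effDom (L t)} := fun y => by
    ext w
    constructor
    · rintro ⟨r, hr⟩
      exact lt_of_eq_of_lt hr (EReal.coe_lt_top r)
    · intro h
      exact ⟨_, (EReal.coe_toReal (ne_of_lt h) (hL.2 _).ne').symm⟩
  have hst : stateSet L t = Prod.fst '' effDom (L t) := by
    ext y
    change (dynamicsSet L t y).Nonempty ↔ _
    rw [hdyn]
    constructor
    · rintro ⟨w, hw⟩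
      exact ⟨(y, w), hw, rfl⟩
    · rintro ⟨⟨_, w⟩, hw, rfl⟩
      exact ⟨w, hw⟩
  have hD : Convex ℝ (effDom (L t)) := by
    rw [← image_fst_epi]
    exact hLc.linear_image (LinearMap.fst ℝ _ _)
  apply prodMk_mem_relCore hD
  · rw [← hst]
    exact intrinsicInterior_subset_relCore _ hx
  · rw [← hdyn]
    exact intrinsicInterior_subset_relCore _ hv

theorem conjugate_primalValue_le_dualValue (hL : ∀ t ∈ Finset.Icc 1 T, IsProper (L t))
    (hg : IsProper g) {τ : ℕ} (hτ : τ ≤ T) (η : Vec n) :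
    conjugate (primalValue T L g τ) η ≤ dualValue T L g τ η := by
  refine iSup_le fun ξ => le_iInf₂ fun p hp => ?_
  have hbot := bot_lt_dualCost hL hg hτ p
  rcases eq_or_ne (dualCost T L g τ p) ⊤ with htop | htop
  · exact htop ▸ le_top
  refine EReal.sub_le_of_le_add ?_
  rw [add_comm]
  -- The finite dual cost is moved across so that the infimum over `x` stands alone on the right.
  refine (EReal.sub_le_iff_le_add (Or.inl hbot.ne') (Or.inl htop)).1 ?_
  refine le_iInf₂ fun x hx => ?_
  refine (EReal.sub_le_iff_le_add (Or.inl hbot.ne') (Or.inl htop)).2 ?_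
  have := inner_le_primalCost_add_dualCost hL hg hτ x p
  rwa [hx, hp, neg_neg] at this

end Costs

end Bolza

/-! ### The duality theorem -/

open Bolza in
theorem mainTheorem2 {n : ℕ} (T : ℕ) (L : ℕ → Bolza.Vec n × Bolza.Vec n → EReal)
    (g : Bolza.Vec n → EReal)
    (hL : ∀ t ∈ Finset.Icc 1 T, Bolza.IsProperConvexLsc (L t))
    (hg : Bolza.IsProperConvexLsc g)
    (hH : Bolza.PrimalStrictlyFeasible T L g)
    (τ : ℕ) (hτ : τ ≤ T) :
    Bolza.conjugate (Bolza.primalValue T L g τ) = Bolza.dualValue T L g τ ∧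
    ∀ η ∈ Bolza.effDom (Bolza.dualValue T L g τ),
      ∃ p : ℕ → Bolza.Vec n, p τ = -η ∧
        Bolza.dualCost T L g τ p = Bolza.dualValue T L g τ η := by
  have hLp : ∀ t ∈ Finset.Icc 1 T, IsProper (L t) := fun t ht => (hL t ht).proper
  have hLc : ∀ t ∈ Finset.Icc 1 T, Convex ℝ (epi (L t)) := fun t ht => (hL t ht).convex
  obtain ⟨x, hxT, hx⟩ := hH
  have hxT' := intrinsicInterior_subset_relCore _ hxT
  have hx' : ∀ t ∈ Finset.Icc 1 T, (x (t - 1), x t - x (t - 1)) ∈ relCore (effDom (L t)) :=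
    fun t ht => mem_relCore_effDom_of_mem_intrinsicInterior (hLp t ht) (hLc t ht)
      (hx t ht).1 (hx t ht).2
  -- This keeps the conjugate above `-∞`; where it is below `+∞` it is thus a real bound `M` for
  -- `exists_dualCost_le`.
  have hdom : (effDom (primalValue T L g τ)).Nonempty := by
    obtain ⟨⟨⟨ξ, r⟩, ⟨y, hy, hr⟩, -⟩, -⟩ :=
      mem_relCore_costEpi hLp hg.proper hLc hg.convex hxT' hx' hτ
    exact ⟨ξ, lt_of_le_of_lt (iInf₂_le_of_le y hy hr) (EReal.coe_lt_top r)⟩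
  have hstrong : ∀ η, conjugate (primalValue T L g τ) η < ⊤ → ∃ p : ℕ → Vec n, p τ = -η ∧
      dualCost T L g τ p ≤ conjugate (primalValue T L g τ) η := fun η hη => by
    have hM := EReal.coe_toReal hη.ne (bot_lt_conjugate hdom η).ne'
    rw [← hM]
    refine exists_dualCost_le hLp hg.proper hLc hg.convex hxT' hx' hτ η _ ?_
    rintro ⟨ξ, r⟩ ⟨y, hy, hr⟩
    rw [← EReal.coe_le_coe_iff, hM, EReal.coe_sub]
    exact (EReal.sub_le_sub le_rfl (iInf₂_le_of_le y hy hr)).trans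
      (le_iSup (fun ξ : Vec n => ((inner ℝ ξ η : ℝ) : EReal) - primalValue T L g τ ξ) ξ)
  have heq : conjugate (primalValue T L g τ) = dualValue T L g τ := by
    funext η
    refine le_antisymm (conjugate_primalValue_le_dualValue hLp hg.proper hτ η) ?_
    rcases eq_or_ne (conjugate (primalValue T L g τ) η) ⊤ with htop | htop
    · exact htop ▸ le_top
    · obtain ⟨p, hp, h⟩ := hstrong η (lt_top_iff_ne_top.2 htop)
      exact iInf₂_le_of_le p hp h
  refine ⟨heq, fun η hη => ?_⟩
  obtain ⟨p, hp, h⟩ := hstrong η (by rw [heq]; exact hη)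
  rw [heq] at h
  exact ⟨p, hp, le_antisymm h (iInf₂_le p hp)⟩
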